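/- Consider the $\mathsf{CONGEST}$ model: the input is a connected graph $G$ with vertex set $\{0,\dots,n-1\}$, whose vertices are the computing nodes and whose names are their unique identifiers. All vertices know $n$, and every vertex initially knows its own identifier and those of its neighbours; all vertices run the same algorithm, with unrestricted local computation, in synchronous rounds; in each round every vertex may send to each of its neighbours a message of at most $b$ bits, possibly different for different neighbours. An algorithm solves induced $m$-cycle detection in $T$ rounds on $n$-vertex networks if, for every connected $G$ on $\{0,\dots,n-1\}$, after $T$ rounds at least one vertex reports "yes" if $G$ contains an induced cycle of length $m$, and no vertex does so otherwise. A randomized algorithm (whose vertices may use a common random seed; private coins are a special case) solves the problem if for every such $G$ this holds with probability at least $2/3$. **Theorem.** Let $k \ge 3$ and $\beta \in \mathbb{R}$. There are a constant $c > 0$ and an $n_0$, depending only on $k$ and $\beta$, such that for all $n \ge n_0$, every deterministic algorithm and every randomized algorithm that uses messages of at most $b \le \beta \log n$ bits and solves induced $2k$-cycle detection in $T$ rounds on $n$-vertex networks satisfies $T \ge c\, n/\log n$. That is, induced $2k$-cycle detection needs $\Omega(n/\log n)$ rounds in $\mathsf{CONGEST}$, both deterministically and with randomization. -/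

import Mathlib

namespace Congest

/-- A message of a `CONGEST` network of bandwidth `b`: a string of at most `b` bits.
The empty string also plays the role of sending nothing. -/
def Message (b : ℕ) : Type := {l : List Bool // l.length ≤ b}

/-- The empty message. -/
def Message.silent (b : ℕ) : Message b := ⟨[], Nat.zero_le b⟩

/-- A deterministic distributed algorithm for `n`-vertex networks with bandwidth `b`.

The vertices of the network are `Fin n`, and the name of a vertex is its unique identifier.
All vertices run the same algorithm and know `n`; initially a vertex knows its own identifier
and the identifiers of its neighbours.  Local computation is unrestricted. -/
structure Algorithm (n b : ℕ) where
  /-- the local states of a vertex -/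
  State : Type
  /-- the initial state, from the own identifier and the set of identifiers of the neighbours -/
  init : Fin n → Set (Fin n) → State
  /-- `send s w` is the message that a vertex in state `s` sends to its neighbour `w` -/
  send : State → Fin n → Message b
  /-- the state after a round, from the state before it and the messages received in it,
  indexed by their senders -/
  receive : State → (Fin n → Message b) → State
  /-- whether a vertex that stops in this state reports that the input is a yes-instance -/
  output : State → Bool

namespace Algorithm

variable {n b : ℕ}

open Classical in
/-- The state of each vertex after `t` synchronous rounds on the network `G`: in a round every
vertex sends one message, which may differ from edge to edge, along each incident edge.
Nothing is received from vertices that are not neighbours. -/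
noncomputable def run (A : Algorithm n b) (G : SimpleGraph (Fin n)) : ℕ → Fin n → A.State
  | 0, v => A.init v (G.neighborSet v)
  | t + 1, v =>
      A.receive (A.run G t v) fun w =>
        if G.Adj w v then A.send (A.run G t w) v else Message.silent b

/-- On the network `G`, some vertex reports a yes-instance after `T` rounds. -/
def Accepts (A : Algorithm n b) (T : ℕ) (G : SimpleGraph (Fin n)) : Prop :=
  ∃ v : Fin n, A.output (A.run G T v) = true

/-- After `T` rounds the algorithm answers correctly on `G` whether `G` contains an induced cycle
of length `m`: if it does, at least one vertex reports a yes-instance, and otherwise no vertex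
does.  In particular this holds when all vertices of induced `m`-cycles report a yes-instance
and no vertex does so if there is no such cycle. -/
def CorrectOn (A : Algorithm n b) (m T : ℕ) (G : SimpleGraph (Fin n)) : Prop :=
  A.Accepts T G ↔ (SimpleGraph.cycleGraph m).IsIndContained G

/-- The deterministic algorithm `A` solves induced `m`-cycle detection in `T` rounds on all
connected networks with `n` vertices. -/
def SolvesInducedCycle (A : Algorithm n b) (m T : ℕ) : Prop :=
  ∀ G : SimpleGraph (Fin n), G.Connected → A.CorrectOn m T G

end Algorithm

open MeasureTheory in
/-- A randomized algorithm is a deterministic algorithm `A ω` that depends on a random seed `ω`,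
drawn from a probability space `(Ω, μ)` and known to all vertices.  (Independent private coins are
the case in which `ω` is a family of independent seeds, one for each identifier, and a vertex uses
only its own.)  It solves induced `m`-cycle detection in `T` rounds if on each connected network
with `n` vertices it is correct with probability at least `2/3`. -/
def RandomizedSolvesInducedCycle {n b : ℕ} {Ω : Type*} [MeasurableSpace Ω] (μ : Measure Ω)
    (A : Ω → Algorithm n b) (m T : ℕ) : Prop :=
  ∀ G : SimpleGraph (Fin n), G.Connected →
    MeasurableSet {ω | (A ω).CorrectOn m T G} ∧
      (2 / 3 : ℝ) ≤ μ.real {ω | (A ω).CorrectOn m T G}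

end Congest

/-! The proof reduces from two-party set disjointness on `p * p` elements, one for each pair of
nonzero indices in `Fin (p + 1)`. The gadget has `2k` cyclically ordered cliques of size `p + 1`;
the sets are encoded between levels `0, 1` and between levels `k, k + 1`, with perfect matchings
elsewhere. By `exists_section` an induced `2k`-cycle must wind once around the levels, and the
matchings force it to be a common pair. Only `O(p)` edges leave levels `0, 1`, so `T` rounds amount
to a protocol with `O(p * (b + 1) * T)` bits (`IsSplit.run_eq`).

Disjointness on `N` elements needs `Ω(N)` bits even with shared randomness: rejected inputs with a
fixed transcript form a rectangle, and by `rectangle_bound` a rectangle with many disjoint pairs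
contains proportionally many pairs meeting exactly once, all errors. That corruption bound is
`pairing_one_ge`, an induction on coordinates: `two_point_inequality` handles one coordinate, and
the chain rules `condKL_succ` and `condKL_succ'` add up the entropy losses. With `N = p * p` this
gives `(b + 1) * T = Ω(p)`, where `p` is of order `n / k`. -/

open Finset

/-! ### Unique disjointness: weighted pairs of subsets -/

namespace UniqueDisjointness

/-- The number of common elements of two subsets of `Fin n`. -/
def inter {n : ℕ} (x y : Fin n → Bool) : ℕ := ∑ i, (x i && y i).toNat

theorem inter_comm {n : ℕ} (x y : Fin n → Bool) : inter x y = inter y x := by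
  simp [inter, Bool.and_comm]

theorem inter_cons {n : ℕ} (a b : Bool) (x y : Fin n → Bool) :
    inter (Fin.cons a x : Fin (n + 1) → Bool) (Fin.cons b y) = (a && b).toNat + inter x y := by
  simp [inter, Fin.sum_univ_succ]

theorem sum_cons {n : ℕ} (f : (Fin (n + 1) → Bool) → ℝ) :
    ∑ x, f x = ∑ x : Fin n → Bool, (f (Fin.cons false x) + f (Fin.cons true x)) := by
  rw [← (Fin.consEquiv fun _ => Bool).sum_comp, Fintype.sum_prod_type, Fintype.sum_bool, add_comm,
    ← Finset.sum_add_distrib]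
  rfl

/-- Sum of `u` over all sets that have exactly `j` elements in common with `y`. -/
def slice {n : ℕ} (j : ℕ) (u : (Fin n → Bool) → ℝ) (y : Fin n → Bool) : ℝ :=
  ∑ x, if inter x y = j then u x else 0

/-- The restriction of `u` to the face on which the first coordinate is `a`. -/
def face {n : ℕ} (a : Bool) (u : (Fin (n + 1) → Bool) → ℝ) : (Fin n → Bool) → ℝ :=
  fun x => u (Fin.cons a x)

theorem slice_add {n : ℕ} (j : ℕ) (u w : (Fin n → Bool) → ℝ) (y : Fin n → Bool) :
    slice j (u + w) y = slice j u y + slice j w y := by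
  simp only [slice, ← Finset.sum_add_distrib]
  refine Finset.sum_congr rfl fun x _ => ?_
  split_ifs <;> simp

theorem slice_cons_false {n : ℕ} (j : ℕ) (u : (Fin (n + 1) → Bool) → ℝ) (y : Fin n → Bool) :
    slice j u (Fin.cons false y) = slice j (face false u) y + slice j (face true u) y := by
  simp [slice, sum_cons, inter_cons, face, Finset.sum_add_distrib]

theorem slice_zero_cons_true {n : ℕ} (u : (Fin (n + 1) → Bool) → ℝ) (y : Fin n → Bool) :
    slice 0 u (Fin.cons true y) = slice 0 (face false u) y := by
  simp [slice, sum_cons, inter_cons, face]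

theorem slice_one_cons_true {n : ℕ} (u : (Fin (n + 1) → Bool) → ℝ) (y : Fin n → Bool) :
    slice 1 u (Fin.cons true y) = slice 1 (face false u) y + slice 0 (face true u) y := by
  simp [slice, sum_cons, inter_cons, face, Finset.sum_add_distrib]

theorem slice_nonneg {n : ℕ} {j : ℕ} {u : (Fin n → Bool) → ℝ} (hu : ∀ x, 0 ≤ u x)
    (y : Fin n → Bool) : 0 ≤ slice j u y :=
  Finset.sum_nonneg fun x _ => by split_ifs <;> simp [hu x]

/-- Total weight of the pairs with exactly `j` common elements. -/
def pairing {n : ℕ} (j : ℕ) (u v : (Fin n → Bool) → ℝ) : ℝ := ∑ y, v y * slice j u y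

theorem pairing_comm {n : ℕ} (j : ℕ) (u v : (Fin n → Bool) → ℝ) :
    pairing j u v = pairing j v u := by
  simp only [pairing, slice, Finset.mul_sum]
  rw [Finset.sum_comm]
  refine Finset.sum_congr rfl fun x _ => Finset.sum_congr rfl fun y _ => ?_
  rw [inter_comm]
  split_ifs <;> ring

theorem pairing_add_left {n : ℕ} (j : ℕ) (u w v : (Fin n → Bool) → ℝ) :
    pairing j (u + w) v = pairing j u v + pairing j w v := by
  simp [pairing, slice_add, mul_add, Finset.sum_add_distrib]

theorem pairing_zero_succ {n : ℕ} (u v : (Fin (n + 1) → Bool) → ℝ) :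
    pairing 0 u v =
      pairing 0 (face false u + face true u) (face false v) +
        pairing 0 (face false u) (face true v) := by
  simp [pairing, sum_cons, slice_cons_false, slice_zero_cons_true, slice_add, face,
    Finset.sum_add_distrib]

theorem pairing_one_succ {n : ℕ} (u v : (Fin (n + 1) → Bool) → ℝ) :
    pairing 1 u v =
      pairing 1 (face false u + face true u) (face false v) +
        pairing 1 (face false u) (face true v) + pairing 0 (face true u) (face true v) := by
  simp [pairing, sum_cons, slice_cons_false, slice_one_cons_true, slice_add, face,
    Finset.sum_add_distrib, mul_add, add_assoc]

theorem pairing_zero_one (n : ℕ) : pairing 0 (1 : (Fin n → Bool) → ℝ) 1 = 3 ^ n := by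
  induction n with
  | zero => simp [pairing, slice, inter]
  | succ n ih =>
    have h (a : Bool) : face a (1 : (Fin (n + 1) → Bool) → ℝ) = 1 := rfl
    rw [pairing_zero_succ, h, h, pairing_add_left, ih]
    ring

theorem pairing_one_one (n : ℕ) : pairing 1 (1 : (Fin n → Bool) → ℝ) 1 = n * 3 ^ n / 3 := by
  induction n with
  | zero => simp [pairing, slice, inter]
  | succ n ih =>
    have h (a : Bool) : face a (1 : (Fin (n + 1) → Bool) → ℝ) = 1 := rfl
    rw [pairing_one_succ, h, h, pairing_add_left, ih, pairing_zero_one]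
    push_cast
    ring

theorem slice_zero_one_pos {n : ℕ} (y : Fin n → Bool) :
    0 < slice 0 (1 : (Fin n → Bool) → ℝ) y := by
  refine Finset.sum_pos' (fun x _ => by split_ifs <;> simp) ⟨fun _ => false, Finset.mem_univ _, ?_⟩
  simp [inter]

/-! ### Relative entropy and its chain rules -/

/-- The function `t log t`. -/
noncomputable def xlog (t : ℝ) : ℝ := t * Real.log t

/-- The relative entropy of the two-point measure `(a, b)` with respect to the uniform measure. -/
noncomputable def klTwo (a b : ℝ) : ℝ := xlog a + xlog b - xlog (a + b) + (a + b) * Real.log 2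

/-- The relative entropy, with respect to the uniform measure, of `x` given a disjoint `y`, where
the pair `(x, y)` has weight `u x * v y`. -/
noncomputable def condKL {n : ℕ} (u v : (Fin n → Bool) → ℝ) : ℝ :=
  ∑ y, v y * (slice 0 (fun x => xlog (u x)) y - xlog (slice 0 u y)
    + Real.log (slice 0 1 y) * slice 0 u y)

theorem log_slice_cons_false {n : ℕ} (y : Fin n → Bool) :
    Real.log (slice 0 1 (Fin.cons false y : Fin (n + 1) → Bool)) =
      Real.log (slice 0 1 y) + Real.log 2 := by
  have h (a : Bool) : face a (1 : (Fin (n + 1) → Bool) → ℝ) = 1 := rfl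
  rw [slice_cons_false, h, h, ← two_mul, Real.log_mul two_ne_zero (slice_zero_one_pos y).ne',
    add_comm]

theorem log_slice_cons_true {n : ℕ} (y : Fin n → Bool) :
    Real.log (slice 0 1 (Fin.cons true y : Fin (n + 1) → Bool)) = Real.log (slice 0 1 y) := by
  have h (a : Bool) : face a (1 : (Fin (n + 1) → Bool) → ℝ) = 1 := rfl
  rw [slice_zero_cons_true, h]

theorem slice_klTwo {n : ℕ} (p q : (Fin n → Bool) → ℝ) (y : Fin n → Bool) :
    slice 0 (fun x => klTwo (p x) (q x)) y =
      slice 0 (fun x => xlog (p x)) y + slice 0 (fun x => xlog (q x)) y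
        - slice 0 (fun x => xlog ((p + q) x)) y + (slice 0 (p + q) y) * Real.log 2 := by
  simp only [slice, Finset.sum_mul, ← Finset.sum_add_distrib, ← Finset.sum_sub_distrib]
  refine Finset.sum_congr rfl fun x _ => ?_
  split_ifs <;> simp [klTwo]

theorem face_xlog {n : ℕ} (a : Bool) (u : (Fin (n + 1) → Bool) → ℝ) :
    face a (fun x => xlog (u x)) = fun x => xlog (face a u x) := rfl

/-- Chain rule with the first bit of `x` revealed last. It is forced when `y` contains the first
element, so it contributes only over `face false v`. -/
theorem condKL_succ {n : ℕ} (u v : (Fin (n + 1) → Bool) → ℝ) :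
    condKL u v = condKL (face false u + face true u) (face false v) +
      condKL (face false u) (face true v) +
      ∑ x, slice 0 (face false v) x * klTwo (face false u x) (face true u x) := by
  have h : ∑ x, slice 0 (face false v) x * klTwo (face false u x) (face true u x) =
      ∑ y, face false v y * slice 0 (fun x => klTwo (face false u x) (face true u x)) y := by
    have := pairing_comm 0 (fun x => klTwo (face false u x) (face true u x)) (face false v)
    simp only [pairing] at this
    rw [this]
    exact Finset.sum_congr rfl fun x _ => mul_comm _ _
  rw [h]
  simp only [condKL, sum_cons, ← Finset.sum_add_distrib]
  refine Finset.sum_congr rfl fun y _ => ?_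
  rw [slice_klTwo, log_slice_cons_false, log_slice_cons_true]
  simp only [slice_cons_false, slice_zero_cons_true, slice_add, face_xlog]
  simp only [face]
  ring

/-- Chain rule with the first bit of `y` revealed first, hence the slices inside `klTwo`. With this
order the remaining terms involve the same two pairs of functions as in `condKL_succ`, so one
induction serves both. -/
theorem condKL_succ' {n : ℕ} (u v : (Fin (n + 1) → Bool) → ℝ) :
    condKL v u = condKL (face false v) (face false u + face true u) +
      condKL (face true v) (face false u) +
      ∑ x, face false u x * klTwo (slice 0 (face false v) x) (slice 0 (face true v) x) := by
  simp only [condKL, sum_cons, ← Finset.sum_add_distrib]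
  refine Finset.sum_congr rfl fun y _ => ?_
  rw [log_slice_cons_false, log_slice_cons_true]
  simp only [slice_cons_false, slice_zero_cons_true, klTwo, Pi.add_apply, face_xlog]
  simp only [face]
  ring

theorem sub_le_mul_log_div {a m : ℝ} (ha : 0 ≤ a) (hm : 0 < m) :
    a - m ≤ a * (Real.log a - Real.log m) := by
  rcases ha.eq_or_lt with rfl | ha
  · simp [hm.le]
  · have := Real.one_sub_inv_le_log_of_pos (div_pos ha hm)
    rw [Real.log_div ha.ne' hm.ne'] at this
    calc a - m = a * (1 - (a / m)⁻¹) := by field_simp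
      _ ≤ _ := mul_le_mul_of_nonneg_left this ha.le

/-- Gibbs' inequality, with `(s / 2, t / 2)` as the test distribution. -/
theorem klTwo_ge {a b s t : ℝ} (ha : 0 ≤ a) (hb : 0 ≤ b) (hs : 0 < s) (ht : 0 < t)
    (hst : s + t = 2) : a * Real.log s + b * Real.log t ≤ klTwo a b := by
  rcases (add_nonneg ha hb).eq_or_lt with h | h
  · obtain rfl : a = 0 := by linarith
    obtain rfl : b = 0 := by linarith
    simp [klTwo, xlog]
  · have h1 := sub_le_mul_log_div ha (mul_pos hs (half_pos h))
    have h2 := sub_le_mul_log_div hb (mul_pos ht (half_pos h))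
    rw [Real.log_mul hs.ne' (half_pos h).ne', Real.log_div h.ne' two_ne_zero] at h1
    rw [Real.log_mul ht.ne' (half_pos h).ne', Real.log_div h.ne' two_ne_zero] at h2
    have h3 : a - s * ((a + b) / 2) + (b - t * ((a + b) / 2)) = 0 := by
      obtain rfl : t = 2 - s := by linarith
      ring
    unfold klTwo xlog
    nlinarith [h1, h2, h3]

theorem klTwo_comm (a b : ℝ) : klTwo a b = klTwo b a := by
  simp only [klTwo, add_comm b a]; ring

theorem klTwo_nonneg {a b : ℝ} (ha : 0 ≤ a) (hb : 0 ≤ b) : 0 ≤ klTwo a b := by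
  simpa using klTwo_ge ha hb one_pos one_pos (by norm_num)

theorem le_klTwo_of_le {a b : ℝ} (hb : 0 ≤ b) (hab : b ≤ 7 / 8 * a) : a / 300 ≤ klTwo a b := by
  have ha : 0 ≤ a := by linarith
  -- The test distribution has the extremal ratio `7 / 8`; as `log (14 / 15) ≤ 0`, the worst case is
  -- `b = 7 / 8 * a`.
  refine le_trans ?_ (klTwo_ge (s := 16 / 15) (t := 14 / 15) ha hb (by norm_num) (by norm_num)
    (by norm_num))
  have h1 : Real.log (14 / 15) ≤ 0 := Real.log_nonpos (by norm_num) (by norm_num)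
  have h2 : (8 : ℝ) / 300 ≤ 8 * Real.log (16 / 15) + 7 * Real.log (14 / 15) := by
    have : 8 * Real.log (16 / 15) + 7 * Real.log (14 / 15) =
        Real.log ((16 / 15) ^ 8 * (14 / 15) ^ 7) := by
      rw [Real.log_mul (by norm_num) (by norm_num), Real.log_pow, Real.log_pow]
      norm_num
    rw [this]
    exact le_trans (by norm_num) (Real.one_sub_inv_le_log_of_pos (by norm_num))
  nlinarith [mul_le_mul_of_nonneg_left h2 ha]

/-- If `b` and `d` are not much smaller than `a` and `c`, then `b * d` nearly dominates each of the
three products. Otherwise some bit is biased and its entropy deficit pays. -/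
theorem two_point_inequality {a b c d : ℝ} (ha : 0 ≤ a) (hb : 0 ≤ b) (hc : 0 ≤ c) (hd : 0 ≤ d) :
    1 / 4 * (a * c + b * c + a * d) ≤
      b * d + 300 * (c * klTwo a b + a * klTwo c d) := by
  have k1 := mul_nonneg hc (klTwo_nonneg ha hb)
  have k2 := mul_nonneg ha (klTwo_nonneg hc hd)
  have hac := mul_nonneg ha hc
  have hbc := mul_nonneg hb hc
  have had := mul_nonneg ha hd
  have hbd := mul_nonneg hb hd
  by_cases h1 : b ≤ 7 / 8 * a
  · have e1 := mul_le_mul_of_nonneg_left (le_klTwo_of_le hb h1) hc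
    have e2 : b * c ≤ 7 / 8 * a * c := mul_le_mul_of_nonneg_right h1 hc
    by_cases h2 : c ≤ 7 / 8 * d
    · have e3 := mul_le_mul_of_nonneg_left (le_klTwo_of_le hc h2) ha
      rw [klTwo_comm] at e3
      nlinarith
    · have e3 := mul_le_mul_of_nonneg_left (not_le.mp h2).le ha
      nlinarith
  · by_cases h2 : d ≤ 7 / 8 * c
    · have e1 := mul_le_mul_of_nonneg_left (le_klTwo_of_le hd h2) ha
      have e2 : a * d ≤ a * (7 / 8 * c) := mul_le_mul_of_nonneg_left h2 ha
      by_cases h3 : a ≤ 7 / 8 * b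
      · have e3 := mul_le_mul_of_nonneg_left (le_klTwo_of_le ha h3) hc
        rw [klTwo_comm] at e3
        nlinarith
      · have e3 := mul_le_mul_of_nonneg_right (not_le.mp h3).le hc
        nlinarith
    · have e1 := mul_le_mul_of_nonneg_left (not_le.mp h2).le hb
      have e2 := mul_le_mul_of_nonneg_right (not_le.mp h1).le hd
      have e3 := mul_le_mul_of_nonneg_right (not_le.mp h1).le hc
      nlinarith

/-- General weights are needed even for rectangles, since the induction merges two faces into `face
false u + face true u`. -/
theorem pairing_one_ge {n : ℕ} (u v : (Fin n → Bool) → ℝ) (hu : ∀ x, 0 ≤ u x)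
    (hv : ∀ x, 0 ≤ v x) :
    1 / 4 * (n * pairing 0 u v) ≤ pairing 1 u v + 300 * (condKL u v + condKL v u) := by
  induction n with
  | zero => simp [pairing, slice, condKL, inter]
  | succ n ih =>
    have hu' (a : Bool) (x) : 0 ≤ face a u x := hu _
    have hv' (a : Bool) (x) : 0 ≤ face a v x := hv _
    have i1 := ih (face false u + face true u) (face false v)
      (fun x => add_nonneg (hu' _ x) (hu' _ x)) (hv' _)
    have i2 := ih (face false u) (face true v) (hu' _) (hv' _)
    -- The gain from the new coordinate: pairs that meet there and nowhere else, estimated pointwise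
    -- in the rest of `x`.
    have key : 1 / 4 * pairing 0 u v ≤ pairing 0 (face true u) (face true v) +
        300 * (∑ x, slice 0 (face false v) x * klTwo (face false u x) (face true u x) +
          ∑ x, face false u x * klTwo (slice 0 (face false v) x) (slice 0 (face true v) x)) := by
      rw [pairing_zero_succ, pairing_add_left, pairing_comm 0 (face false u) (face false v),
        pairing_comm 0 (face true u) (face false v), pairing_comm 0 (face false u) (face true v),
        pairing_comm 0 (face true u) (face true v)]
      simp only [pairing, ← Finset.sum_add_distrib, Finset.mul_sum]
      refine Finset.sum_le_sum fun x _ => ?_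
      have := two_point_inequality (hu' false x) (hu' true x)
        (slice_nonneg (j := 0) (hv' false) x) (slice_nonneg (j := 0) (hv' true) x)
      linarith
    rw [pairing_one_succ, condKL_succ u v, condKL_succ' u v]
    have hD := pairing_zero_succ u v
    push_cast
    rw [add_mul, mul_add, one_mul]
    have : 1 / 4 * (n * pairing 0 u v) =
        1 / 4 * (n * pairing 0 (face false u + face true u) (face false v)) +
          1 / 4 * (n * pairing 0 (face false u) (face true v)) := by
      rw [hD]; ring
    linarith

theorem neg_xlog_add_le {s z : ℝ} (hs : 0 ≤ s) (hz : 0 < z) (a : ℝ) :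
    -xlog s + Real.log z * s ≤ a * s + Real.exp (-a) * z := by
  have h := sub_le_mul_log_div hs (mul_pos (Real.exp_pos (-a)) hz)
  rw [Real.log_mul (Real.exp_ne_zero _) hz.ne', Real.log_exp] at h
  unfold xlog
  nlinarith

/-! ### The corruption bound for rectangles -/

/-- The indicator function of a set of subsets. -/
noncomputable def ind {n : ℕ} (A : Set (Fin n → Bool)) : (Fin n → Bool) → ℝ := A.indicator 1

theorem ind_nonneg {n : ℕ} (A : Set (Fin n → Bool)) (x : Fin n → Bool) : 0 ≤ ind A x :=
  Set.indicator_nonneg (fun _ _ => zero_le_one) x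

theorem ind_le_one {n : ℕ} (A : Set (Fin n → Bool)) (x : Fin n → Bool) : ind A x ≤ 1 :=
  Set.indicator_le_self' (fun _ _ => zero_le_one) x

theorem xlog_ind {n : ℕ} (A : Set (Fin n → Bool)) (x : Fin n → Bool) : xlog (ind A x) = 0 := by
  by_cases h : x ∈ A <;> simp [ind, h, xlog]

/-- For an indicator the entropy at `y` is `s * log (z / s)`, with `s` of the `z` sets disjoint from
`y` in `A`. This is at most `a * s` unless `s < exp (-a) * z`, and the second summand covers that
case. -/
theorem condKL_ind_le {n : ℕ} (A B : Set (Fin n → Bool)) (a : ℝ) :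
    condKL (ind A) (ind B) ≤ a * pairing 0 (ind A) (ind B) + Real.exp (-a) * 3 ^ n := by
  rw [← pairing_zero_one]
  simp only [condKL, pairing, Finset.mul_sum, ← Finset.sum_add_distrib]
  refine Finset.sum_le_sum fun y _ => ?_
  have h0 : slice 0 (fun x => xlog (ind A x)) y = 0 := by simp [slice, xlog_ind]
  have h1 := neg_xlog_add_le (slice_nonneg (j := 0) (ind_nonneg A) y) (slice_zero_one_pos y) a
  have h2 := mul_le_mul_of_nonneg_left h1 (ind_nonneg B y)
  have h3 := mul_le_mul_of_nonneg_right (ind_le_one B y)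
    (mul_pos (Real.exp_pos (-a)) (slice_zero_one_pos y)).le
  rw [h0, Pi.one_apply, one_mul]
  nlinarith

/-- In a rectangle with many disjoint pairs, a constant proportion of the pairs that meet in
exactly one element is present. -/
theorem rectangle_bound {n : ℕ} (A B : Set (Fin n → Bool)) :
    5 / 24 * (n * pairing 0 (ind A) (ind B)) ≤
      pairing 1 (ind A) (ind B) + 600 * (Real.exp (-(n / 14400)) * 3 ^ n) := by
  have h := pairing_one_ge _ _ (ind_nonneg A) (ind_nonneg B)
  -- Chosen so that `600 * n / 14400 = n / 24`, leaving `1 / 4 - 1 / 24 = 5 / 24`.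
  have h1 := condKL_ind_le A B (n / 14400)
  have h2 := condKL_ind_le B A (n / 14400)
  rw [pairing_comm 0 (ind B)] at h2
  linarith

end UniqueDisjointness

/-! ### The cycle gadget -/

namespace CycleGadget

theorem natCast_eq_iff {N s t : ℕ} (hs : s < N + 2) (ht : t < N + 2) :
    (s : ZMod (N + 2)) = t ↔ s = t := by
  rw [ZMod.natCast_eq_natCast_iff', Nat.mod_eq_of_lt hs, Nat.mod_eq_of_lt ht]

theorem val_add_one {N : ℕ} {w : ZMod (N + 2)} (h : w + 1 ≠ 0) : (w + 1).val = w.val + 1 := by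
  have hw : w.val ≤ N + 1 := Nat.lt_succ_iff.mp (ZMod.val_lt w)
  have h1 : (1 : ZMod (N + 2)).val = 1 := (ZMod.val_one_eq_one_mod _).trans (by simp)
  rw [ZMod.val_add_of_lt, h1]
  rw [h1]
  refine Nat.add_lt_add_right (lt_of_le_of_ne hw fun h' => h ?_) 1
  rw [← ZMod.natCast_zmod_val w, h']
  exact_mod_cast ZMod.natCast_self (N + 2)

/-- Let every level of `G` be a clique and let edges join only equal or cyclically consecutive
levels.  Then an induced cycle whose length is the number of levels meets each level once. -/
theorem exists_section {N : ℕ} (hN : 3 ≤ N) {V : Type*} (G : SimpleGraph V)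
    (lev : V → ZMod (N + 2)) (h1 : ∀ a b, a ≠ b → lev a = lev b → G.Adj a b)
    (h2 : ∀ a b, G.Adj a b → lev a = lev b ∨ lev b = lev a + 1 ∨ lev a = lev b + 1)
    (f : SimpleGraph.cycleGraph (N + 2) ↪g G) :
    ∃ v : ZMod (N + 2) → V, (∀ l, lev (v l) = l) ∧ ∀ l, G.Adj (v l) (v (l + 1)) := by
  have n1 : (1 : ZMod (N + 2)) ≠ 0 := by
    have := natCast_eq_iff (N := N) (s := 1) (t := 0) (by omega) (by omega)
    simpa using this
  have n2 : (2 : ZMod (N + 2)) ≠ 0 := by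
    have := natCast_eq_iff (N := N) (s := 2) (t := 0) (by omega) (by omega)
    simpa using this
  have n3 : (3 : ZMod (N + 2)) ≠ 0 := by
    have := natCast_eq_iff (N := N) (s := 3) (t := 0) (by omega) (by omega)
    simpa using this
  have n4 : (4 : ZMod (N + 2)) ≠ 0 := by
    have := natCast_eq_iff (N := N) (s := 4) (t := 0) (by omega) (by omega)
    simpa using this
  obtain ⟨g, ginj, hg⟩ : ∃ g : ZMod (N + 2) → V, Function.Injective g ∧
      ∀ s t, G.Adj (g s) (g t) ↔ s - t = 1 ∨ t - s = 1 :=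
    ⟨f, f.injective, fun s t => f.map_adj_iff.trans SimpleGraph.cycleGraph_adj⟩
  have hsucc (t) : G.Adj (g t) (g (t + 1)) := (hg _ _).2 (Or.inr (by ring))
  have hlev {s t} (hst : s ≠ t) (h : lev (g s) = lev (g t)) : s - t = 1 ∨ t - s = 1 :=
    (hg _ _).1 (h1 _ _ (ginj.ne hst) h)
  have htwo (t) : lev (g t) ≠ lev (g (t + 1 + 1)) := fun h => by
    rcases hlev (fun e => n2 (by linear_combination -e)) h with e | e
    · exact n3 (by linear_combination -e)
    · exact n1 (by linear_combination e)
  have hthree (t) : lev (g t) ≠ lev (g (t + 1 + 1 + 1)) := fun h => by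
    rcases hlev (fun e => n3 (by linear_combination -e)) h with e | e
    · exact n4 (by linear_combination -e)
    · exact n2 (by linear_combination e)
  have hsurj : Function.Surjective (lev ∘ g) := by
    by_contra hns
    simp only [Function.Surjective, not_forall, not_exists, Function.comp] at hns
    obtain ⟨z, hz⟩ := hns
    -- Cutting the circle of levels at a missed level `z` gives an integer height that changes by at
    -- most one per step.
    set lam : ZMod (N + 2) → ℕ := fun t => (lev (g t) - z).val with hlam
    have hlamlev (s t) : lam s = lam t → lev (g s) = lev (g t) := fun h =>
      sub_left_injective (ZMod.val_injective _ h)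
    have hup {s t} (h : lev (g t) = lev (g s) + 1) : lam t = lam s + 1 := by
      have e : lev (g t) - z = (lev (g s) - z) + 1 := by rw [h]; ring
      have : lev (g s) - z + 1 ≠ 0 := e ▸ sub_ne_zero.2 (hz t)
      simp only [hlam, e, val_add_one this]
    have hstep (t) : lam t = lam (t + 1) ∨ lam (t + 1) = lam t + 1 ∨ lam t = lam (t + 1) + 1 := by
      rcases h2 _ _ (hsucc t) with h | h | h
      · exact Or.inl (by simp only [hlam, h])
      · exact Or.inr (Or.inl (hup h))
      · exact Or.inr (Or.inr (hup h))
    -- At the maximum, either both neighbours are one lower, or two consecutive positions are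
    -- maximal and the positions around them are one lower, or three are maximal. Each case repeats
    -- a level at distance two or three, against `htwo` and `hthree`.
    obtain ⟨t, ht⟩ := Finite.exists_max lam
    have key (s) (hs : lam s = lam t) (hs' : lam (s + 1) = lam t) : False := by
      have e1 := hstep (s - 1)
      have e2 := hstep (s + 1)
      have f1 := htwo (s - 1)
      have f2 := htwo s
      have f3 := hthree (s - 1)
      rw [sub_add_cancel] at e1 f1 f3
      have m1 := ht (s - 1)
      have m2 := ht (s + 1 + 1)
      have g1 := mt (hlamlev _ _) f1
      have g2 := mt (hlamlev _ _) f2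
      have g3 := mt (hlamlev _ _) f3
      omega
    have e1 := hstep (t - 1)
    have e2 := hstep t
    have f1 := mt (hlamlev _ _) (htwo (t - 1))
    have k1 := key (t - 1)
    have k2 := key t rfl
    rw [sub_add_cancel] at e1 f1 k1
    have m1 := ht (t - 1)
    have m2 := ht (t + 1)
    by_cases c1 : lam (t - 1) = lam t
    · exact k1 c1 rfl
    by_cases c2 : lam (t + 1) = lam t
    · exact k2 c2
    omega
  have hinj : Function.Injective (lev ∘ g) := Finite.injective_iff_surjective.2 hsurj
  choose inv hinv using hsurj
  simp only [Function.comp] at hinv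
  refine ⟨fun l => g (inv l), hinv, fun l => ?_⟩
  have hne (s t) (h : lev (g s) = lev (g t)) : s = t := hinj h
  have a1 := h2 _ _ (hsucc (inv l))
  have a2 := h2 _ _ (hsucc (inv l - 1))
  rw [sub_add_cancel] at a2
  -- The cycle may run around the levels in either direction.
  have key : inv (l + 1) = inv l + 1 ∨ inv (l + 1) = inv l - 1 := by
    rcases a1 with h | h | h
    · exact absurd (hne _ _ h) fun e => n1 (by linear_combination -e)
    · exact Or.inl (hne _ _ (by rw [hinv, h, hinv]))
    · rcases a2 with h' | h' | h'
      · exact absurd (hne _ _ h') fun e => n1 (by linear_combination -e)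
      · exact absurd (hne (inv l + 1) (inv l - 1) (by linear_combination h' - h))
          fun e => n2 (by linear_combination e)
      · exact Or.inr (hne _ _ (by rw [hinv, h', hinv]))
  rcases key with h | h <;> simp only [h]
  · exact hsucc _
  · simpa using (hsucc (inv l - 1)).symm

/-- Vertices of the gadget: `q` vertices on each of `N + 2` cyclically ordered levels, and `r`
padding vertices. -/
abbrev Vertex (N q r : ℕ) : Type := (ZMod (N + 2) × Fin q) ⊕ Fin r

/-- The level of a vertex. -/
def level {N q r : ℕ} : Vertex N q r → ZMod (N + 2)
  | .inl p => p.1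
  | .inr _ => 2

/-- The edges from one level to the next: given by `X` above level `0`, by `Y` above level `k`, and
a perfect matching elsewhere. -/
def Up {N q r : ℕ} (k : ℕ) (X Y : Fin q → Fin q → Prop) : Vertex N q r → Vertex N q r → Prop
  | .inl (l, i), .inl (l', j) =>
    l' = l + 1 ∧ ((l = 0 → X i j) ∧ (l = k → Y j i) ∧ (l ≠ 0 → l ≠ k → i = j))
  | _, _ => False

/-- The graph in which every level is a clique and consecutive levels are joined by `Up`. -/
def gadget {N q : ℕ} (r k : ℕ) (X Y : Fin q → Fin q → Prop) : SimpleGraph (Vertex N q r) :=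
  SimpleGraph.fromRel fun a b => level a = level b ∨ Up k X Y a b

section

variable {N q r k : ℕ} {X Y : Fin q → Fin q → Prop}

theorem Up.level_eq {a b : Vertex N q r} (h : Up k X Y a b) : level b = level a + 1 := by
  rcases a with ⟨l, i⟩ | a <;> rcases b with ⟨l', j⟩ | b <;> simp only [Up] at h
  exact h.1

theorem one_ne_zero' : (1 : ZMod (N + 2)) ≠ 0 := by
  have := natCast_eq_iff (N := N) (s := 1) (t := 0) (by omega) (by omega)
  simpa using this

theorem Up.ne {a b : Vertex N q r} (h : Up k X Y a b) : a ≠ b := fun e => by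
  have := h.level_eq
  rw [e] at this
  exact one_ne_zero' (by linear_combination -this)

theorem gadget_adj {a b : Vertex N q r} : (gadget r k X Y).Adj a b ↔
    (a ≠ b ∧ level a = level b) ∨ Up k X Y a b ∨ Up k X Y b a := by
  simp only [gadget, SimpleGraph.fromRel_adj]
  constructor
  · rintro ⟨hne, (h | h) | (h | h)⟩
    exacts [Or.inl ⟨hne, h⟩, Or.inr (Or.inl h), Or.inl ⟨hne, h.symm⟩, Or.inr (Or.inr h)]
  · rintro (⟨hne, h⟩ | h | h)
    exacts [⟨hne, Or.inl (Or.inl h)⟩, ⟨h.ne, Or.inl (Or.inr h)⟩, ⟨h.ne.symm, Or.inr (Or.inr h)⟩]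

/-- The matchings keep the index constant on levels `1, …, k` and on levels `k + 1, …, 2k = 0`, so
the two encoded edges join the same two indices. Padding vertices have no `Up` edges and cannot
occur. -/
theorem exists_of_cycle (hN : 3 ≤ N) (hk : N + 2 = 2 * k)
    (f : SimpleGraph.cycleGraph (N + 2) ↪g (gadget r k X Y : SimpleGraph (Vertex N q r))) :
    ∃ i j, X i j ∧ Y i j := by
  obtain ⟨v, hv, hadj⟩ := exists_section hN _ level
    (fun a b hne h => gadget_adj.2 (Or.inl ⟨hne, h⟩))
    (fun a b h => by
      rcases gadget_adj.1 h with h | h | h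
      exacts [Or.inl h.2, Or.inr (Or.inl h.level_eq), Or.inr (Or.inr h.level_eq)]) f
  have hup (l) : Up k X Y (v l) (v (l + 1)) := by
    rcases gadget_adj.1 (hadj l) with h | h | h
    · rw [hv, hv] at h
      exact absurd h.2 fun e => one_ne_zero' (by linear_combination -e)
    · exact h
    · have := h.level_eq
      rw [hv, hv] at this
      have h2 := natCast_eq_iff (N := N) (s := 2) (t := 0) (by omega) (by omega)
      exact absurd (h2.1 (by push_cast; linear_combination -this)) (by omega)
  have hc (l) : ∃ i, v l = .inl (l, i) := by
    have h := hup l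
    have h' := hv l
    generalize v l = a at h h'
    rcases a with ⟨l', i⟩ | a
    · exact ⟨i, by rw [← h']; rfl⟩
    · exact h.elim
  choose c hc using hc
  have hup' (l) := (hc l ▸ hc (l + 1) ▸ hup l :
    Up k X Y (.inl (l, c l) : Vertex N q r) (.inl (l + 1, c (l + 1))))
  simp only [Up, true_and] at hup'
  have hkL : k < N + 2 := by omega
  have c1 (s : ℕ) (hs : 1 + s ≤ k) : c ((1 + s : ℕ) : ZMod (N + 2)) = c 1 := by
    induction s with
    | zero => simp
    | succ s ih =>
      rw [← ih (by omega)]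
      have h := (hup' ((1 + s : ℕ) : ZMod (N + 2))).2.2
        (by rw [← Nat.cast_zero, Ne, natCast_eq_iff (by omega) (by omega)]; omega)
        (by rw [Ne, natCast_eq_iff (by omega) (by omega)]; omega)
      rw [h]; push_cast; ring_nf
  have c2 (s : ℕ) (hs : k + 1 + s ≤ N + 2) :
      c ((k + 1 + s : ℕ) : ZMod (N + 2)) = c (k + 1) := by
    induction s with
    | zero => simp
    | succ s ih =>
      rw [← ih (by omega)]
      have h := (hup' ((k + 1 + s : ℕ) : ZMod (N + 2))).2.2
        (by rw [← Nat.cast_zero, Ne, natCast_eq_iff (by omega) (by omega)]; omega)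
        (by rw [Ne, natCast_eq_iff (by omega) (by omega)]; omega)
      rw [h]; push_cast; ring_nf
  have e1 : c k = c 1 := by
    have := c1 (k - 1) (by omega)
    rwa [show 1 + (k - 1) = k by omega] at this
  have e2 : c 0 = c (k + 1) := by
    have := c2 (N + 1 - k) (by omega)
    rwa [show k + 1 + (N + 1 - k) = N + 2 by omega, ZMod.natCast_self] at this
  refine ⟨c 0, c 1, ?_, ?_⟩
  · simpa using (hup' 0).1
  · have := (hup' k).2.1 rfl
    rwa [← e2, e1] at this

theorem cycle_of_exists (hk : N + 2 = 2 * k) (hN : 1 ≤ N) {i j : Fin q} (hX : X i j) (hY : Y i j) :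
    Nonempty (SimpleGraph.cycleGraph (N + 2) ↪g
      (gadget r k X Y : SimpleGraph (Vertex N q r))) := by
  let c : ZMod (N + 2) → Fin q := fun l => if 1 ≤ l.val ∧ l.val ≤ k then j else i
  have hkL : k < N + 2 := by omega
  have hup (l l' : ZMod (N + 2)) :
      Up k X Y (.inl (l, c l) : Vertex N q r) (.inl (l', c l')) ↔ l' - l = 1 := by
    simp only [Up, sub_eq_iff_eq_add']
    refine ⟨fun h => h.1, fun h => ⟨h, ?_⟩⟩
    subst h
    refine ⟨?_, ?_, ?_⟩
    · rintro rfl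
      have : (1 : ZMod (N + 2)).val = 1 := ZMod.val_one_eq_one_mod _ |>.trans (by simp)
      simpa [c, this, show 1 ≤ k by omega] using hX
    · rintro rfl
      have e1 : (k : ZMod (N + 2)).val = k := ZMod.val_cast_of_lt hkL
      have e2 : ((k : ZMod (N + 2)) + 1).val = k + 1 := by
        rw [← Nat.cast_add_one, ZMod.val_cast_of_lt (by omega)]
      simpa [c, e1, e2, show 1 ≤ k by omega] using hY
    · intro h0 hk'
      have h0' : l.val ≠ 0 := fun h => h0 ((ZMod.val_eq_zero l).1 h)
      have hk'' : l.val ≠ k := fun h => hk' (by rw [← h, ZMod.natCast_zmod_val])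
      by_cases h1 : l + 1 = 0
      · have : l.val = N + 1 := by
          rw [eq_neg_of_add_eq_zero_left h1]
          exact ZMod.val_neg_one (N + 1)
        simp [c, h1, this, show ¬ N + 1 ≤ k by omega]
      · simp only [c, val_add_one h1]
        congr 1
        simp only [eq_iff_iff]
        omega
  let g : ZMod (N + 2) ↪ Vertex N q r := ⟨fun l => .inl (l, c l), fun _ _ h => congrArg level h⟩
  have hg (l l' : ZMod (N + 2)) : (gadget r k X Y).Adj (g l) (g l') ↔ l - l' = 1 ∨ l' - l = 1 := by
    refine gadget_adj.trans ?_
    change _ ∨ Up k X Y (.inl (l, c l) : Vertex N q r) (.inl (l', c l')) ∨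
      Up k X Y (.inl (l', c l') : Vertex N q r) (.inl (l, c l)) ↔ _
    rw [hup, hup]
    constructor
    · rintro (⟨hne, h⟩ | h | h)
      · change l = l' at h
        subst h
        exact absurd rfl hne
      · exact Or.inr h
      · exact Or.inl h
    · rintro (h | h)
      exacts [Or.inr (Or.inr h), Or.inr (Or.inl h)]
  exact ⟨⟨g, fun {l l'} => (hg l l').trans SimpleGraph.cycleGraph_adj.symm⟩⟩

/-- Index `i` is followed from level `k + 1` around to level `k`, which avoids the edges given by
`Y`; the cliques reach the rest. -/
theorem gadget_connected (hk : N + 2 = 2 * k) (hN : 1 ≤ N) {i : Fin q} (hX : X i i) :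
    (gadget r k X Y : SimpleGraph (Vertex N q r)).Connected := by
  have hkL : k < N + 2 := by omega
  have hs (s : ℕ) (hs : s < 2 * k) : (gadget r k X Y : SimpleGraph (Vertex N q r)).Reachable
      (.inl (k + 1, i)) (.inl (((k + 1 + s : ℕ) : ZMod (N + 2)), i)) := by
    induction s with
    | zero => simp
    | succ s ih =>
      refine (ih (by omega)).trans (SimpleGraph.Adj.reachable (gadget_adj.2 (Or.inr (Or.inl ?_))))
      refine ⟨by push_cast; ring, fun _ => hX, fun h => ?_, fun _ _ => rfl⟩
      have : ((s + 1 : ℕ) : ZMod (N + 2)) = (0 : ℕ) := by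
        push_cast at h ⊢; linear_combination h
      rw [natCast_eq_iff (by omega) (by omega)] at this
      omega
  have hl (l : ZMod (N + 2)) : (gadget r k X Y : SimpleGraph (Vertex N q r)).Reachable
      (.inl (k + 1, i)) (.inl (l, i)) := by
    have := hs (l - (k + 1)).val (hk ▸ ZMod.val_lt _)
    push_cast at this
    rwa [ZMod.natCast_zmod_val, add_sub_cancel] at this
  have : Nonempty (Vertex N q r) := ⟨.inl (0, i)⟩
  have hall (a : Vertex N q r) : (gadget r k X Y : SimpleGraph (Vertex N q r)).Reachable
      (.inl (k + 1, i)) a := by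
    refine (hl (level a)).trans ?_
    by_cases h : .inl (level a, i) = a
    · rw [h]
    · exact SimpleGraph.Adj.reachable (gadget_adj.2 (Or.inl ⟨h, rfl⟩))
  exact ⟨fun a b => (hall a).symm.trans (hall b)⟩

/-! ### The split of the gadget between two parties -/

theorem adj_iff_of_near (hk : N + 2 = 2 * k) (hN : 3 ≤ N) {Y' : Fin q → Fin q → Prop}
    {v : Vertex N q r} (hv : level v = 0 ∨ level v = 1) (w : Vertex N q r) :
    (gadget r k X Y).Adj v w ↔ (gadget r k X Y').Adj v w := by
  have hkL : k < N + 2 := by omega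
  have k0 : (k : ZMod (N + 2)) ≠ 0 := by
    rw [← Nat.cast_zero, Ne, natCast_eq_iff hkL (by omega)]; omega
  have k1 : (k : ZMod (N + 2)) ≠ 1 := by
    rw [← Nat.cast_one, Ne, natCast_eq_iff hkL (by omega)]; omega
  have k2 : (k : ZMod (N + 2)) + 1 ≠ 0 := by
    rw [← Nat.cast_zero, ← Nat.cast_add_one, Ne, natCast_eq_iff (by omega) (by omega)]; omega
  have u1 : Up k X Y v w ↔ Up k X Y' v w := by
    rcases v with ⟨l, i⟩ | v <;> rcases w with ⟨l', j⟩ | w <;> simp only [Up]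
    have : l ≠ k := by rintro rfl; exact hv.elim k0 k1
    simp [this]
  have u2 : Up k X Y w v ↔ Up k X Y' w v := by
    rcases v with ⟨l, i⟩ | v <;> rcases w with ⟨l', j⟩ | w <;> simp only [Up]
    refine and_congr_right fun h => ?_
    have : l' ≠ k := by
      rintro rfl
      simp only [level, h] at hv
      exact hv.elim k2 fun h => k0 (by linear_combination h)
    simp [this]
  rw [gadget_adj, gadget_adj, u1, u2]

theorem adj_iff_of_far {X' : Fin q → Fin q → Prop}
    {v : Vertex N q r} (hv : ¬ (level v = 0 ∨ level v = 1)) (w : Vertex N q r) :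
    (gadget r k X Y).Adj v w ↔ (gadget r k X' Y).Adj v w := by
  have u1 : Up k X Y v w ↔ Up k X' Y v w := by
    rcases v with ⟨l, i⟩ | v <;> rcases w with ⟨l', j⟩ | w <;> simp only [Up]
    have : l ≠ 0 := fun h => hv (Or.inl h)
    simp [this]
  have u2 : Up k X Y w v ↔ Up k X' Y w v := by
    rcases v with ⟨l, i⟩ | v <;> rcases w with ⟨l', j⟩ | w <;> simp only [Up]
    refine and_congr_right fun h => ?_
    have : l' ≠ 0 := by
      rintro rfl
      exact hv (Or.inr (h.trans (zero_add 1)))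
    simp [this]
  rw [gadget_adj, gadget_adj, u1, u2]

/-- The ordered pairs of adjacent vertices of which exactly one lies on level `0` or `1`. -/
def cutPair (N : ℕ) {q : ℕ} (r : ℕ) : Bool × Bool × Fin q → Vertex N q r × Vertex N q r
  | (false, false, i) => (.inl (1, i), .inl (2, i))
  | (false, true, i) => (.inl (2, i), .inl (1, i))
  | (true, false, i) => (.inl (0, i), .inl (-1, i))
  | (true, true, i) => (.inl (-1, i), .inl (0, i))

theorem mem_range_cutPair (hk : N + 2 = 2 * k) (hN : 3 ≤ N) {v w : Vertex N q r}
    (hv : level v = 0 ∨ level v = 1) (hw : ¬ (level w = 0 ∨ level w = 1))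
    (h : (gadget r k X Y).Adj v w) :
    (v, w) ∈ Set.range (cutPair N r) ∧ (w, v) ∈ Set.range (cutPair N r) := by
  have hkL : k < N + 2 := by omega
  have k1 : (k : ZMod (N + 2)) ≠ 1 := by
    rw [← Nat.cast_one, Ne, natCast_eq_iff hkL (by omega)]; omega
  have k2 : (k : ZMod (N + 2)) + 1 ≠ 0 := by
    rw [← Nat.cast_zero, ← Nat.cast_add_one, Ne, natCast_eq_iff (by omega) (by omega)]; omega
  rcases gadget_adj.1 h with h | h | h
  · exact absurd (h.2 ▸ hv) hw
  · rcases v with ⟨l, i⟩ | v <;> rcases w with ⟨l', j⟩ | w <;> simp only [Up] at h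
    simp only [level] at hv hw
    obtain ⟨rfl, -, -, h⟩ := h
    rcases hv with rfl | rfl
    · exact absurd (Or.inr (zero_add 1)) hw
    · obtain rfl := h one_ne_zero' k1.symm
      rw [one_add_one_eq_two]
      exact ⟨⟨(false, false, i), rfl⟩, ⟨(false, true, i), rfl⟩⟩
  · rcases v with ⟨l, i⟩ | v <;> rcases w with ⟨l', j⟩ | w <;> simp only [Up] at h
    simp only [level] at hv hw
    obtain ⟨rfl, -, -, h⟩ := h
    rcases hv with hv | hv
    · obtain rfl := h (fun e => hw (Or.inl e)) fun e => k2 (e ▸ hv)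
      obtain rfl := eq_neg_of_add_eq_zero_left hv
      rw [neg_add_cancel]
      exact ⟨⟨(true, false, j), rfl⟩, ⟨(true, true, j), rfl⟩⟩
    · exact absurd (Or.inl (by linear_combination hv)) hw

end

end CycleGadget

/-! ### Counting over a partition into rectangles -/

namespace UniqueDisjointness

open Classical in
/-- The number of pairs with exactly `j` common elements that satisfy `P`. -/
noncomputable def count {n : ℕ} (j : ℕ) (P : (Fin n → Bool) → (Fin n → Bool) → Prop) : ℝ :=
  ∑ y, ∑ x, if inter x y = j ∧ P x y then 1 else 0

theorem count_true (n j : ℕ) :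
    count j (fun _ _ : Fin n → Bool => True) = pairing j (1 : (Fin n → Bool) → ℝ) 1 := by
  simp [count, pairing, slice]

/-- If the pairs satisfying `P` split into few rectangles, then a constant proportion of `P` has
exactly one common element. -/
theorem count_bound {n : ℕ} {κ : Type*} [Fintype κ] (P : (Fin n → Bool) → (Fin n → Bool) → Prop)
    (τ : (Fin n → Bool) → (Fin n → Bool) → κ)
    (hrect : ∀ x y x' y', P x y → P x' y' → τ x y = τ x' y' → P x y' ∧ τ x y' = τ x y) :
    5 / 24 * (n * count 0 P) ≤
      count 1 P + Fintype.card κ * (600 * (Real.exp (-(n / 14400)) * 3 ^ n)) := by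
  classical
  let R (t : κ) : Set (Fin n → Bool) := {x | ∃ y, P x y ∧ τ x y = t}
  let C (t : κ) : Set (Fin n → Bool) := {y | ∃ x, P x y ∧ τ x y = t}
  have hcount (j : ℕ) : count j P = ∑ t, pairing j (ind (R t)) (ind (C t)) := by
    simp only [pairing, slice, Finset.mul_sum]
    rw [Finset.sum_comm]
    refine Finset.sum_congr rfl fun y _ => ?_
    rw [Finset.sum_comm]
    refine Finset.sum_congr rfl fun x _ => ?_
    have hterm (t : κ) : ind (C t) y * (if inter x y = j then ind (R t) x else 0) =
        if τ x y = t then (if inter x y = j ∧ P x y then 1 else 0) else 0 := by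
      have hmem : x ∈ R t ∧ y ∈ C t ↔ P x y ∧ τ x y = t := by
        constructor
        · rintro ⟨⟨y', h, e⟩, x', h', e'⟩
          obtain ⟨h1, h2⟩ := hrect _ _ _ _ h h' (e.trans e'.symm)
          exact ⟨h1, h2.trans e⟩
        · rintro ⟨h, e⟩
          exact ⟨⟨y, h, e⟩, x, h, e⟩
      simp only [ind, Set.indicator_apply, Pi.one_apply]
      by_cases h1 : x ∈ R t <;> by_cases h2 : y ∈ C t <;> by_cases h3 : inter x y = j <;>
        simp only [h1, h2, h3] at hmem ⊢ <;> by_cases h4 : τ x y = t <;> simp_all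
    simp only [hterm, Finset.sum_ite_eq, Finset.mem_univ, if_true]
  rw [hcount, hcount, Finset.mul_sum, Finset.mul_sum, ← nsmul_eq_mul, ← Finset.card_univ,
    ← Finset.sum_const, ← Finset.sum_add_distrib]
  exact Finset.sum_le_sum fun t _ => rectangle_bound _ _

end UniqueDisjointness

/-! ### Simulation by a two-party protocol -/

namespace Congest

theorem message_injective (b : ℕ) : Function.Injective
    (fun m : Message b => (⟨⟨m.1.length, Nat.lt_succ_of_le m.2⟩, ⟨m.1, rfl⟩⟩ :
      Σ i : Fin (b + 1), List.Vector Bool i)) := by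
  intro m m' h
  exact Subtype.ext (congrArg (fun s : Σ i : Fin (b + 1), List.Vector Bool i => s.2.1) h)

noncomputable instance (b : ℕ) : Fintype (Message b) :=
  Fintype.ofInjective _ (message_injective b)

theorem card_message_le (b : ℕ) : Fintype.card (Message b) ≤ 2 ^ (b + 1) := by
  refine (Fintype.card_le_of_injective _ (message_injective b)).trans ?_
  simp only [Fintype.card_sigma, card_vector, Fintype.card_bool]
  rw [Fin.sum_univ_eq_sum_range (fun i => 2 ^ i)]
  exact (Nat.geomSum_lt le_rfl (by simp)).le

section Simulation

variable {n b : ℕ} {α β C : Type*}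

/-- The graph `G x y` is divided into a side `S`, whose adjacencies depend on `x` only, and its
complement, whose adjacencies depend on `y` only; the edges between them are among `cut`. -/
structure IsSplit (G : α → β → SimpleGraph (Fin n)) (S : Set (Fin n))
    (cut : C → Fin n × Fin n) : Prop where
  near : ∀ x y y' v, v ∈ S → ∀ w, (G x y).Adj v w ↔ (G x y').Adj v w
  far : ∀ x x' y v, v ∉ S → ∀ w, (G x y).Adj v w ↔ (G x' y).Adj v w
  cut : ∀ x y v w, v ∈ S → w ∉ S → (G x y).Adj v w →
    (v, w) ∈ Set.range cut ∧ (w, v) ∈ Set.range cut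

/-- The messages sent along the pairs in `cut` in the first `T` rounds. -/
noncomputable def transcript (A : Algorithm n b) (G : SimpleGraph (Fin n)) (cut : C → Fin n × Fin n)
    (T : ℕ) : Fin T → C → Message b :=
  fun t c => A.send (A.run G t (cut c).1) (cut c).2

variable {G : α → β → SimpleGraph (Fin n)} {S : Set (Fin n)} {cut : C → Fin n × Fin n}

/-- Cut and paste: on the mixed input each side sees its own part of the graph and, round by round,
the same messages across the cut as in its original run. -/
theorem IsSplit.run_eq (h : IsSplit G S cut) (A : Algorithm n b) {T : ℕ} {x x' : α} {y y' : β}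
    (hτ : transcript A (G x y) cut T = transcript A (G x' y') cut T) {t : ℕ} (ht : t ≤ T) :
    (∀ v ∈ S, A.run (G x y') t v = A.run (G x y) t v) ∧
      ∀ v ∉ S, A.run (G x y') t v = A.run (G x' y') t v := by
  induction t with
  | zero =>
    refine ⟨fun v hv => ?_, fun v hv => ?_⟩ <;> simp only [Algorithm.run] <;> congr 1 <;> ext w
    · exact h.near x y' y v hv w
    · exact h.far x x' y' v hv w
  | succ t ih =>
    obtain ⟨ih1, ih2⟩ := ih (by omega)
    have hτ' (c : C) : A.send (A.run (G x y) t (cut c).1) (cut c).2 =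
        A.send (A.run (G x' y') t (cut c).1) (cut c).2 := congrFun (congrFun hτ ⟨t, ht⟩) c
    refine ⟨fun v hv => ?_, fun v hv => ?_⟩ <;> simp only [Algorithm.run]
    · rw [ih1 v hv]
      congr 1
      funext w
      have hadj : (G x y').Adj w v ↔ (G x y).Adj w v := by
        rw [SimpleGraph.adj_comm, h.near x y' y v hv w, SimpleGraph.adj_comm]
      by_cases hwv : (G x y).Adj w v
      · rw [if_pos (hadj.2 hwv), if_pos hwv]
        by_cases hw : w ∈ S
        · rw [ih1 w hw]
        · obtain ⟨c, hc⟩ := (h.cut x y v w hv hw hwv.symm).2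
          have := hτ' c
          rw [hc] at this
          rw [ih2 w hw]
          exact this.symm
      · rw [if_neg (mt hadj.1 hwv), if_neg hwv]
    · rw [ih2 v hv]
      congr 1
      funext w
      have hadj : (G x y').Adj w v ↔ (G x' y').Adj w v := by
        rw [SimpleGraph.adj_comm, h.far x x' y' v hv w, SimpleGraph.adj_comm]
      by_cases hwv : (G x' y').Adj w v
      · rw [if_pos (hadj.2 hwv), if_pos hwv]
        by_cases hw : w ∈ S
        · obtain ⟨c, hc⟩ := (h.cut x' y' w v hw hv hwv).1
          have := hτ' c
          rw [hc] at this
          rw [ih1 w hw]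
          exact this
        · rw [ih2 w hw]
      · rw [if_neg (mt hadj.1 hwv), if_neg hwv]

/-- The inputs that are rejected with a given transcript form a rectangle. -/
theorem IsSplit.rectangle (h : IsSplit G S cut)
    (A : Algorithm n b) {T : ℕ} {x x' : α} {y y' : β}
    (hxy : ¬ A.Accepts T (G x y)) (hxy' : ¬ A.Accepts T (G x' y'))
    (hτ : transcript A (G x y) cut T = transcript A (G x' y') cut T) :
    ¬ A.Accepts T (G x y') ∧ transcript A (G x y') cut T = transcript A (G x y) cut T := by
  constructor
  -- Rejection is needed on both inputs: every vertex ends as in one of the two runs, so an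
  -- accepting vertex would have accepted there.
  · rintro ⟨v, hv⟩
    by_cases hvS : v ∈ S
    · exact hxy ⟨v, by rwa [← (h.run_eq A hτ le_rfl).1 v hvS]⟩
    · exact hxy' ⟨v, by rwa [← (h.run_eq A hτ le_rfl).2 v hvS]⟩
  · funext t c
    by_cases hc : (cut c).1 ∈ S
    · simp only [transcript, (h.run_eq A hτ t.2.le).1 _ hc]
    · rw [hτ]
      simp only [transcript, (h.run_eq A hτ t.2.le).2 _ hc]

end Simulation

-- The averaging direction of Yao's principle: a bound for every seed bounds the expectation.
open MeasureTheory in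
theorem sum_le_of_prob {Ω ι : Type*} [Fintype ι] [MeasurableSpace Ω] (μ : Measure Ω)
    [IsProbabilityMeasure μ] (E : ι → Set Ω) (hE : ∀ i, MeasurableSet (E i)) {p : ℝ}
    (hp : ∀ i, p ≤ μ.real (E i)) (w : ι → ℝ) (hw : ∀ i, 0 ≤ w i) {B : ℝ}
    (hB : ∀ ω, ∑ i, w i * (E i).indicator 1 ω ≤ B) : p * ∑ i, w i ≤ B := by
  have hint (i) : Integrable (fun ω => w i * (E i).indicator (1 : Ω → ℝ) ω) μ :=
    ((integrable_const (1 : ℝ)).indicator (hE i)).const_mul _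
  calc p * ∑ i, w i ≤ ∑ i, w i * μ.real (E i) := by
        rw [Finset.mul_sum]
        exact Finset.sum_le_sum fun i _ => by
          rw [mul_comm]; exact mul_le_mul_of_nonneg_left (hp i) (hw i)
    _ = ∫ ω, ∑ i, w i * (E i).indicator (1 : Ω → ℝ) ω ∂μ := by
        rw [integral_finsetSum _ fun i _ => hint i]
        refine Finset.sum_congr rfl fun i _ => ?_
        rw [integral_const_mul, integral_indicator_one (hE i)]
    _ ≤ ∫ _, B ∂μ := integral_mono (integrable_finsetSum _ fun i _ => hint i)
        (integrable_const B) hB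
    _ = B := by simp

open UniqueDisjointness MeasureTheory in
/-- A randomized algorithm that decides on a split family of graphs whether two sets meet has many
transcripts. -/
theorem card_transcript_ge {n b N m T : ℕ} {C Ω : Type*} [Fintype C] [DecidableEq C]
    [MeasurableSpace Ω] (μ : Measure Ω) [IsProbabilityMeasure μ]
    {G : (Fin N → Bool) → (Fin N → Bool) → SimpleGraph (Fin n)} {S : Set (Fin n)}
    {cut : C → Fin n × Fin n} (h : IsSplit G S cut) (hconn : ∀ x y, (G x y).Connected)
    (hG : ∀ x y, (SimpleGraph.cycleGraph m).IsIndContained (G x y) ↔ inter x y ≠ 0)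
    (A : Ω → Algorithm n b) (hA : RandomizedSolvesInducedCycle μ A m T) :
    (N : ℝ) / 36 ≤
      Fintype.card (Fin T → C → Message b) * (600 * Real.exp (-(N / 14400))) := by
  classical
  -- The weights match `count_bound`: rejected disjoint pairs are paid for by wrongly rejected pairs
  -- with one common element.
  let w (p : (Fin N → Bool) × (Fin N → Bool)) : ℝ :=
    5 / 24 * N * (if inter p.2 p.1 = 0 then 1 else 0) + if inter p.2 p.1 = 1 then 1 else 0
  have hw (p) : 0 ≤ w p := by
    simp only [w]; positivity
  have key := sum_le_of_prob μ (fun p : (Fin N → Bool) × (Fin N → Bool) =>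
      {ω | (A ω).CorrectOn m T (G p.2 p.1)}) (fun p => (hA _ (hconn _ _)).1) (p := 2 / 3)
    (fun p => (hA _ (hconn _ _)).2) w hw
    (B := pairing 1 (1 : (Fin N → Bool) → ℝ) 1 + Fintype.card (Fin T → C → Message b) *
      (600 * (Real.exp (-(N / 14400)) * 3 ^ N))) fun ω => by
    have hb := count_bound (fun x y => ¬ (A ω).Accepts T (G x y))
      (fun x y => transcript (A ω) (G x y) cut T)
      (fun x y x' y' => h.rectangle (A ω))
    have hsum : ∑ p, w p * Set.indicator {ω | (A ω).CorrectOn m T (G p.2 p.1)} 1 ω =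
        5 / 24 * (N * count 0 fun x y => ¬ (A ω).Accepts T (G x y)) +
          (count 1 (fun _ _ : Fin N → Bool => True) -
            count 1 fun x y => ¬ (A ω).Accepts T (G x y)) := by
      simp only [count, Finset.mul_sum, ← Finset.sum_sub_distrib, ← Finset.sum_add_distrib]
      rw [Fintype.sum_prod_type]
      refine Finset.sum_congr rfl fun y _ => Finset.sum_congr rfl fun x _ => ?_
      simp only [w, Set.indicator_apply, Set.mem_ofPred_eq, Algorithm.CorrectOn, hG]
      by_cases h0 : inter x y = 0
      · by_cases hacc : (A ω).Accepts T (G x y) <;> simp [h0, hacc]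
      · by_cases h1 : inter x y = 1 <;> by_cases hacc : (A ω).Accepts T (G x y) <;>
          simp [h0, h1, hacc]
    rw [hsum, count_true]
    linarith
  have htot : ∑ p, w p = 5 / 24 * (N * pairing 0 (1 : (Fin N → Bool) → ℝ) 1) +
      pairing 1 (1 : (Fin N → Bool) → ℝ) 1 := by
    rw [← count_true N 0, ← count_true N 1]
    simp only [count, Finset.mul_sum, ← Finset.sum_add_distrib]
    rw [Fintype.sum_prod_type]
    refine Finset.sum_congr rfl fun y _ => Finset.sum_congr rfl fun x _ => ?_
    simp [w]
  -- In units of `N * 3 ^ N`: `2 / 3 * (5 / 24 + 1 / 3) - 1 / 3 = 1 / 36`.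
  rw [htot, pairing_zero_one, pairing_one_one] at key
  have h3 : (0 : ℝ) < 3 ^ N := by positivity
  refine le_of_mul_le_mul_right ?_ h3
  nlinarith

theorem card_transcript_le {b T : ℕ} {C : Type*} [Fintype C] [DecidableEq C] :
    Fintype.card (Fin T → C → Message b) ≤ 2 ^ ((b + 1) * Fintype.card C * T) := by
  rw [Fintype.card_fun, Fintype.card_fun, Fintype.card_fin, pow_mul, pow_mul]
  gcongr
  exact card_message_le b

/-! ### Assembly and constants -/

open CycleGadget UniqueDisjointness

theorem inter_ne_zero_iff {N : ℕ} (x y : Fin N → Bool) :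
    inter x y ≠ 0 ↔ ∃ s, x s = true ∧ y s = true := by
  simp [inter, Finset.sum_eq_zero_iff]

/-- The bipartite relation encoded by a set of pairs; `s` stands for the `s`-th pair of nonzero
indices. -/
def relation {p : ℕ} (x : Fin (p * p) → Bool) (i j : Fin (p + 1)) : Prop :=
  ∃ s, x s = true ∧ i = (finProdFinEquiv.symm s).1.succ ∧ j = (finProdFinEquiv.symm s).2.succ

theorem exists_relation_iff {p : ℕ} (x y : Fin (p * p) → Bool) :
    (∃ i j, ((i = 0 ∧ j = 0) ∨ relation x i j) ∧ relation y i j) ↔ inter x y ≠ 0 := by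
  rw [inter_ne_zero_iff]
  constructor
  · rintro ⟨i, j, h, s, hs, rfl, rfl⟩
    rcases h with h | ⟨s', hs', h1, h2⟩
    · exact absurd h.1 (Fin.succ_ne_zero _)
    · have : s = s' := finProdFinEquiv.symm.injective
        (Prod.ext (Fin.succ_injective _ h1) (Fin.succ_injective _ h2))
      exact ⟨s, this ▸ hs', hs⟩
  · rintro ⟨s, hx, hy⟩
    exact ⟨_, _, Or.inr ⟨s, hx, rfl, rfl⟩, s, hy, rfl, rfl⟩

open MeasureTheory in
theorem rounds_bound {k p n b T : ℕ} (hk : 3 ≤ k) (hp : 1000 ≤ p) (hn : 2 * k * (p + 1) ≤ n)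
    {Ω : Type*} [MeasurableSpace Ω] (μ : Measure Ω) [IsProbabilityMeasure μ]
    (A : Ω → Algorithm n b) (hA : RandomizedSolvesInducedCycle μ A (2 * k) T) :
    (p : ℝ) / 230400 ≤ (b + 1) * T := by
  obtain ⟨N, hN⟩ : ∃ N, N + 2 = 2 * k := ⟨2 * k - 2, by omega⟩
  have hcard : Fintype.card (Vertex N (p + 1) (n - 2 * k * (p + 1))) = n := by
    rw [Fintype.card_sum, Fintype.card_prod, ZMod.card, Fintype.card_fin, Fintype.card_fin, hN]
    omega
  let e := (Fintype.equivFinOfCardEq hcard).symm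
  let Γ (x y : Fin (p * p) → Bool) :=
    -- The extra edge at index `0` ensures connectedness; `relation y` never uses that index, so no
    -- cycle is created.
    (gadget (n - 2 * k * (p + 1)) k (fun i j => (i = 0 ∧ j = 0) ∨ relation x i j) (relation y) :
      SimpleGraph (Vertex N (p + 1) (n - 2 * k * (p + 1))))
  let G (x y : Fin (p * p) → Bool) := (Γ x y).comap e
  have iso (x y) : G x y ≃g Γ x y := SimpleGraph.Iso.comap e (Γ x y)
  have hsplit : IsSplit G {v | level (e v) = 0 ∨ level (e v) = 1}
      (fun c => Prod.map e.symm e.symm (cutPair N (n - 2 * k * (p + 1)) c)) := by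
    refine ⟨fun x y y' v hv w => adj_iff_of_near hN (by omega) hv _,
      fun x x' y v hv w => adj_iff_of_far hv _, fun x y v w hv hw hvw => ?_⟩
    obtain ⟨⟨c, hc⟩, c', hc'⟩ := mem_range_cutPair hN (by omega) hv hw hvw
    exact ⟨⟨c, by simp [hc]⟩, c', by simp [hc']⟩
  have h1 := card_transcript_ge (N := p * p) μ hsplit
    (fun x y => (iso x y).connected_iff.2 (gadget_connected hN (by omega) (Or.inl ⟨rfl, rfl⟩)))
    (fun x y => by
      rw [← exists_relation_iff, ← hN]
      constructor
      · rintro ⟨f⟩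
        exact exists_of_cycle (by omega) hN ((iso x y).toEmbedding.comp f)
      · rintro ⟨i, j, hX, hY⟩
        obtain ⟨f⟩ := cycle_of_exists (r := n - 2 * k * (p + 1))
          (X := fun i j => (i = 0 ∧ j = 0) ∨ relation x i j) (Y := relation y)
          hN (by omega) hX hY
        exact ⟨(iso x y).symm.toEmbedding.comp f⟩) A hA
  have h2 := card_transcript_le (b := b) (T := T) (C := Bool × Bool × Fin (p + 1))
  simp only [Fintype.card_prod, Fintype.card_bool, Fintype.card_fin] at h2
  set M : ℕ := (b + 1) * (2 * (2 * (p + 1))) * T with hM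
  have hp' : (1000 : ℝ) ≤ p := by exact_mod_cast hp
  -- The `15` absorbs the constant `36 * 600 = 21600 ≤ 2 ^ 15`.
  have h3 : Real.exp (((p * p : ℕ) : ℝ) / 14400) ≤ Real.exp (15 + M) := by
    have hx := Real.exp_pos (((p * p : ℕ) : ℝ) / 14400)
    have h2' : (Fintype.card (Fin T → Bool × Bool × Fin (p + 1) → Message b) : ℝ) ≤ 2 ^ M := by
      exact_mod_cast h2
    have h4 : (1 : ℝ) ≤ ((p * p : ℕ) : ℝ) := by push_cast; nlinarith
    have h5 : (2 : ℝ) ^ (15 + M) ≤ Real.exp (15 + M) := by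
      have : (2 : ℝ) ≤ Real.exp 1 := by linarith [Real.add_one_le_exp (1 : ℝ)]
      calc (2 : ℝ) ^ (15 + M) ≤ Real.exp 1 ^ (15 + M) := by gcongr
        _ = Real.exp (15 + M) := by rw [← Real.exp_nat_mul]; push_cast; rw [mul_one]
    rw [Real.exp_neg] at h1
    have h6 := h1.trans (mul_le_mul_of_nonneg_right h2' (by positivity))
    have h7 : ((p * p : ℕ) : ℝ) / 36 * Real.exp (((p * p : ℕ) : ℝ) / 14400) ≤ 2 ^ M * 600 := by
      calc _ ≤ 2 ^ M * (600 * (Real.exp (((p * p : ℕ) : ℝ) / 14400))⁻¹) *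
            Real.exp (((p * p : ℕ) : ℝ) / 14400) := mul_le_mul_of_nonneg_right h6 hx.le
        _ = 2 ^ M * 600 := by field_simp
    have h8 : (0 : ℝ) < 2 ^ M := by positivity
    rw [pow_add] at h5
    refine le_trans ?_ h5
    nlinarith [mul_le_mul_of_nonneg_right h4 hx.le]
  have h4 := Real.exp_le_exp.1 h3
  rw [hM] at h4
  push_cast at h4
  have hbT : (0 : ℝ) ≤ (b + 1) * T := by positivity
  have hp0 : (0 : ℝ) < p := by linarith
  refine le_of_mul_le_mul_right ?_ hp0
  nlinarith [mul_le_mul_of_nonneg_left hp' hbT]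

end Congest

open Congest in
theorem exists_rounds_bound (k : ℕ) (hk : 3 ≤ k) (β : ℝ) :
    ∃ c : ℝ, 0 < c ∧ ∃ n₀ : ℕ, ∀ n : ℕ, n₀ ≤ n → ∀ b : ℕ, (b : ℝ) ≤ β * Real.log n → ∀ T : ℕ,
      ∀ (Ω : Type*) [MeasurableSpace Ω] (μ : MeasureTheory.Measure Ω)
        [MeasureTheory.IsProbabilityMeasure μ] (A : Ω → Algorithm n b),
        RandomizedSolvesInducedCycle μ A (2 * k) T → c * (n / Real.log n) ≤ T := by
  have hk0 : (0 : ℝ) < k := by exact_mod_cast (by omega : 0 < k)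
  -- Here `921600 = 4 * 230400`, from `n ≤ 4 * k * p`; `|β| + 1` bounds `b + 1` once `log n ≥ 1`;
  -- and `4004 * k` makes `p ≥ 2001`.
  refine ⟨1 / (921600 * k * (|β| + 1)), by positivity, 4004 * k, ?_⟩
  intro n hn b hb T Ω _ μ _ A hA
  have hq := Nat.div_mul_le_self n (2 * k)
  have hq2 := Nat.lt_div_mul_add (a := n) (b := 2 * k) (by omega)
  have hq3 : 2002 ≤ n / (2 * k) := (Nat.le_div_iff_mul_le (by omega)).2 (by linarith)
  obtain ⟨p, hp⟩ : ∃ p, n / (2 * k) = p + 1 := ⟨n / (2 * k) - 1, by omega⟩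
  rw [hp] at hq hq2 hq3
  have key := rounds_bound (p := p) hk (by omega) (by linarith) μ A hA
  have hnR : (n : ℝ) < (p + 1) * (2 * k) + 2 * k := by exact_mod_cast hq2
  have hpR : (2001 : ℝ) ≤ p := by exact_mod_cast (by omega : 2001 ≤ p)
  have hn' : (n : ℝ) ≤ 4 * k * p := by
    have : 0 ≤ (k : ℝ) * (p - 2) := mul_nonneg hk0.le (by linarith)
    linarith
  have hn3 : Real.exp 1 ≤ n := by
    have : (3 : ℝ) ≤ n := by exact_mod_cast (by omega : 3 ≤ n)
    linarith [Real.exp_one_lt_d9]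
  have hlog : 1 ≤ Real.log n := (Real.le_log_iff_exp_le ((Real.exp_pos 1).trans_le hn3)).2 hn3
  have hb1 : (b : ℝ) + 1 ≤ (|β| + 1) * Real.log n := by
    have := mul_le_mul_of_nonneg_right (le_abs_self β) (zero_le_one.trans hlog)
    linarith
  have hT : (0 : ℝ) ≤ T := Nat.cast_nonneg T
  have hlog0 : 0 < Real.log n := by linarith
  have h1 : (p : ℝ) / 230400 ≤ (|β| + 1) * Real.log n * T :=
    key.trans (mul_le_mul_of_nonneg_right hb1 hT)
  rw [div_mul_div_comm, one_mul, div_le_iff₀ (by positivity)]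
  have h2 := mul_le_mul_of_nonneg_left h1 hk0.le
  linarith

theorem mainTheorem1 (k : ℕ) (hk : 3 ≤ k) (β : ℝ) :
    ∃ c : ℝ, 0 < c ∧ ∃ n₀ : ℕ, ∀ n : ℕ, n₀ ≤ n → ∀ b : ℕ, (b : ℝ) ≤ β * Real.log n → ∀ T : ℕ,
      (∀ A : Congest.Algorithm n b, A.SolvesInducedCycle (2 * k) T →
        c * (n / Real.log n) ≤ T) ∧
      (∀ (Ω : Type*) [MeasurableSpace Ω] (μ : MeasureTheory.Measure Ω)
        [MeasureTheory.IsProbabilityMeasure μ] (A : Ω → Congest.Algorithm n b),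
        Congest.RandomizedSolvesInducedCycle μ A (2 * k) T →
          c * (n / Real.log n) ≤ T) := by
  obtain ⟨c, hc, n₀, h⟩ := exists_rounds_bound k hk β
  refine ⟨c, hc, n₀, fun n hn b hb T => ⟨fun A hA => ?_, fun Ω _ μ _ A hA => h n hn b hb T Ω μ A hA⟩⟩
  refine h n hn b hb T PUnit (MeasureTheory.Measure.dirac PUnit.unit) (fun _ => A) fun G hG => ?_
  have : {ω : PUnit | A.CorrectOn (2 * k) T G} = Set.univ :=
    Set.eq_univ_of_forall fun _ => hA G hG
  rw [this]
  exact ⟨MeasurableSet.univ, by norm_num⟩
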